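/- **Setting (LF with refinements, LFR, in canonical-forms style).** The syntax, up to renaming of bound variables, is $$\begin{array}{ll} R ::= c \mid x \mid R\,N,\quad N ::= R \mid \lambda x.N & \text{(atomic, normal terms)}\\ P ::= a \mid P\,N,\quad A,B ::= P \mid \Pi x{:}A.B,\quad K ::= \mathsf{type} \mid \Pi x{:}A.K & \text{(types, kinds)}\\ Q ::= s \mid Q\,N,\quad S,T ::= Q \mid \Pi x{::}S{\sqsubset}A.\,T \mid \top \mid S_1\wedge S_2 & \text{(sorts)}\\ L ::= \mathsf{sort} \mid \Pi x{::}S{\sqsubset}A.\,L \mid \top \mid L_1\wedge L_2 & \text{(classes)}\\ \Gamma ::= \cdot \mid \Gamma, x{::}S{\sqsubset}A,\qquad \Sigma ::= \cdot \mid \Sigma, D & \text{(contexts, signatures)}\\ D ::= a{:}K \mid c{:}A \mid s{\sqsubset}a{::}L \mid s_1\le s_2 \mid c{::}S & \text{(declarations)}\\ \alpha,\beta ::= a \mid \alpha\to\beta & \text{(simple types)} \end{array}$$ The erasure $A^-$ to simple types is $a^-=a$, $(P\,N)^-=P^-$, $(\Pi x{:}A.B)^-=A^-\to B^-$. The $\eta$-expansion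 is $\eta_a(R)=R$, $\eta_{\alpha\to\beta}(R)=\lambda x.\,\eta_\beta(R\,\eta_\alpha(x))$ with $x$ fresh, and $\eta_A(R):=\eta_{A^-}(R)$. $|\Gamma|$ and $|\Sigma|$ are the LF context and LF signature obtained by keeping only the declarations $x{:}A$ of $\Gamma$, and only the declarations $a{:}K$ and $c{:}A$ of $\Sigma$. *Hereditary substitution* $[N_0/x_0]_{\alpha_0}$ (written $[N_0/x_0]_A$ when $\alpha_0=A^-$) is a partial operation. On an atomic term whose head is not $x_0$ it acts compositionally and yields an atomic term. On an atomic term with head $x_0$ it yields a normal term with a simple type: $x_0\mapsto(N_0,\alpha_0)$; and if $R_1\mapsto(\lambda x.N_1,\alpha_2\to\alpha_1)$, $[N_0/x_0]_{\alpha_0}N_2=N_2'$ and $[N_2'/x]_{\alpha_2}N_1=N_1'$, then $R_1\,N_2\mapsto(N_1',\alpha_1)$. On a normal term $R$ with head $x_0$ it is defined with value $R'$ iff $R\mapsto(R',a)$ with $R'$ atomic and $a$ a base type. On everything else it is compositional and capture-avoiding. *LF judgments* are the usual ones of canonical LF over $|\Sigma|$: $R\Rightarrow A$ and $N\Leftarrow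 A$ for terms, $P\Rightarrow K$, well-formedness of types, kinds and contexts; application uses hereditary substitution, and an atomic term is checked only at an atomic type, by equality of types. *LFR judgments* over $\Sigma$ are generated by: - $\Gamma\vdash R\Rightarrow S$: $c\Rightarrow S$ if $c{::}S\in\Sigma$; $x\Rightarrow S$ if $x{::}S{\sqsubset}A\in\Gamma$; if $R\Rightarrow\Pi x{::}S{\sqsubset}A.T$, $N\Leftarrow S$ and $[N/x]_A T=T'$ then $R\,N\Rightarrow T'$; if $R\Rightarrow S_1\wedge S_2$ then $R\Rightarrow S_1$ and $R\Rightarrow S_2$. - $\Gamma\vdash N\Leftarrow S$: $R\Leftarrow Q$ if $R\Rightarrow Q'$ and $Q'\le Q$; $\lambda x.N\Leftarrow\Pi x{::}S{\sqsubset}A.T$ if $\Gamma,x{::}S{\sqsubset}A\vdash N\Leftarrow T$; $N\Leftarrow\top$ always; $N\Leftarrow S_1\wedge S_2$ if $N\Leftarrow S_1$ and $N\Leftarrow S_2$. Here $\le$ is the reflexive-transitive closure of $s_1\,N_1\cdots N_n\le s_2\,N_1\cdots N_n$ for $s_1\le s_2\in\Sigma$. - $\Gamma\vdash Q\sqsubset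 P\Rightarrow L$: $s\sqsubset a\Rightarrow L$ if $s{\sqsubset}a{::}L\in\Sigma$; if $Q\sqsubset P\Rightarrow\Pi x{::}S{\sqsubset}A.L$, $N\Leftarrow S$ and $[N/x]_A L=L'$ then $Q\,N\sqsubset P\,N\Rightarrow L'$; and from $L_1\wedge L_2$ to $L_1$ and to $L_2$. - $\Gamma\vdash S\sqsubset A$: $Q\sqsubset P$ if $Q\sqsubset P\Rightarrow\mathsf{sort}$; $\Pi x{::}S{\sqsubset}A.T\sqsubset\Pi x{:}A.B$ if $S\sqsubset A$ and $\Gamma,x{::}S{\sqsubset}A\vdash T\sqsubset B$; $\top\sqsubset A$ always; $S_1\wedge S_2\sqsubset A$ if $S_1\sqsubset A$ and $S_2\sqsubset A$. The judgment $\Gamma\vdash L\sqsubset K$ is defined analogously, with $\mathsf{sort}\sqsubset\mathsf{type}$. - A context is well formed if each of its declarations $x{::}S{\sqsubset}A$ satisfies $S\sqsubset A$ over the preceding ones. A signature is well formed if in each declaration, relative to the preceding ones, $K$ in $a{:}K$ is an LF kind and $A$ in $c{:}A$ is an LF type (both closed); in $s{\sqsubset}a{::}L$, $a{:}K$ is declared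 and $\cdot\vdash L\sqsubset K$; in $c{::}S$, $c{:}A$ is declared and $\cdot\vdash S\sqsubset A$; in $s_1\le s_2$, both $s_i{\sqsubset}a{::}L$ are declared with the same $a$ and $L$; and nothing is declared twice in the same form ($a{:}$, $c{:}$, $s{\sqsubset}$, $c{::}$). **Theorem.** Let $\Sigma$ be a well-formed signature, $\Gamma$ a context such that $\Gamma$ is well formed and $|\Gamma|$ is a well-formed LF context, $A$ a well-formed LF type over $|\Gamma|$, and $S$ a sort with $\Gamma\vdash S\sqsubset A$. 1. (Expansion) If $\Gamma\vdash R\Rightarrow S$, then $\Gamma\vdash\eta_A(R)\Leftarrow S$. If moreover $|\Gamma|\vdash R\Rightarrow A$ in LF, then also $|\Gamma|\vdash\eta_A(R)\Leftarrow A$ in LF. 2. (Identity) $\Gamma,x{::}S{\sqsubset}A\vdash\eta_A(x)\Leftarrow S$, and $|\Gamma|,x{:}A\vdash\eta_A(x)\Leftarrow A$ in LF. -/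

import Mathlib

/-!
LF with refinements (LFR), in canonical-forms style. Variables are de Bruijn indices and contexts
are lists whose head is the most recent declaration, so terms are taken up to α-equivalence.
-/

namespace LFR

/-- Identifiers of the type constants `a`. -/
abbrev TConst := ℕ
/-- Identifiers of the term constants `c`. -/
abbrev OConst := ℕ
/-- Identifiers of the sort constants `s`. -/
abbrev SConst := ℕ

/-! ### Grammar -/

mutual
/-- Atomic terms `R ::= c | x | R N`. -/
inductive Atm : Type
  | const : OConst → Atm
  | var : ℕ → Atm
  | app : Atm → Nrm → Atm
/-- Normal terms `N ::= R | λx. N`. -/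
inductive Nrm : Type
  | atom : Atm → Nrm
  | lam : Nrm → Nrm
end

/-- Atomic type families `P ::= a | P N`. -/
inductive ATy : Type
  | const : TConst → ATy
  | app : ATy → Nrm → ATy

/-- Normal type families `A ::= P | Πx:A. B`. -/
inductive Ty : Type
  | atom : ATy → Ty
  | pi : Ty → Ty → Ty

/-- Kinds `K ::= type | Πx:A. K`. -/
inductive Knd : Type
  | type : Knd
  | pi : Ty → Knd → Knd

/-- Atomic sort families `Q ::= s | Q N`. -/
inductive ASrt : Type
  | const : SConst → ASrt
  | app : ASrt → Nrm → ASrt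

/-- Normal sort families `S ::= Q | Πx::S⊏A. T | ⊤ | S₁ ∧ S₂`. -/
inductive Srt : Type
  | atom : ASrt → Srt
  | pi : Srt → Ty → Srt → Srt
  | top : Srt
  | inter : Srt → Srt → Srt

/-- Classes `L ::= sort | Πx::S⊏A. L | ⊤ | L₁ ∧ L₂`. -/
inductive Cls : Type
  | sort : Cls
  | pi : Srt → Ty → Cls → Cls
  | top : Cls
  | inter : Cls → Cls → Cls

/-- Simple types `α ::= a | α₁ → α₂`. -/
inductive STy : Type
  | base : TConst → STy
  | arr : STy → STy → STy

/-- LF declarations `a : K` and `c : A`. -/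
inductive LFDecl : Type
  | ty : TConst → Knd → LFDecl
  | tm : OConst → Ty → LFDecl

/-- LF signatures; the head of the list is the last declaration. -/
abbrev LFSig := List LFDecl

/-- LF contexts; the head of the list is the last declaration. -/
abbrev LFCtx := List Ty

/-- LFR declarations: `a : K`, `c : A`, `s ⊏ a :: L`, `s₁ ≤ s₂` and `c :: S`. -/
inductive Decl : Type
  | ty : TConst → Knd → Decl
  | tm : OConst → Ty → Decl
  | srt : SConst → TConst → Cls → Decl
  | sub : SConst → SConst → Decl
  | tmSrt : OConst → Srt → Decl

/-- LFR signatures; the head of the list is the last declaration. -/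
abbrev Sig := List Decl

/-- LFR contexts, lists of declarations `x :: S ⊏ A`; the head is the last declaration. -/
abbrev Ctx := List (Srt × Ty)

/-! ### Erasures -/

/-- The simple type of an atomic type family, i.e. its head. -/
def ATy.erase : ATy → STy
  | .const a => .base a
  | .app P _ => P.erase

/-- Erasure of dependencies from a type. -/
def Ty.erase : Ty → STy
  | .atom P => P.erase
  | .pi A B => .arr A.erase B.erase

/-- The LF part of a declaration, if there is one. -/
def Decl.eraseRefs : Decl → Option LFDecl
  | .ty a K => some (.ty a K)
  | .tm c A => some (.tm c A)
  | .srt _ _ _ => none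
  | .sub _ _ => none
  | .tmSrt _ _ => none

/-- Erasure of refinements from a signature. -/
def eraseSig (Sg : Sig) : LFSig := Sg.filterMap Decl.eraseRefs

/-- Erasure of refinements from a context. -/
def eraseCtx (Γ : Ctx) : LFCtx := Γ.map Prod.snd

/-! ### Renaming and weakening -/

/-- The extension of a renaming under one binder. -/
def upRen (ρ : ℕ → ℕ) : ℕ → ℕ
  | 0 => 0
  | i + 1 => ρ i + 1

mutual
def Atm.ren (ρ : ℕ → ℕ) : Atm → Atm
  | .const c => .const c
  | .var i => .var (ρ i)
  | .app R N => .app (R.ren ρ) (N.ren ρ)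
def Nrm.ren (ρ : ℕ → ℕ) : Nrm → Nrm
  | .atom R => .atom (R.ren ρ)
  | .lam N => .lam (N.ren (upRen ρ))
end

def ATy.ren (ρ : ℕ → ℕ) : ATy → ATy
  | .const a => .const a
  | .app P N => .app (P.ren ρ) (N.ren ρ)

def Ty.ren (ρ : ℕ → ℕ) : Ty → Ty
  | .atom P => .atom (P.ren ρ)
  | .pi A B => .pi (A.ren ρ) (B.ren (upRen ρ))

def ASrt.ren (ρ : ℕ → ℕ) : ASrt → ASrt
  | .const s => .const s
  | .app Q N => .app (Q.ren ρ) (N.ren ρ)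

def Srt.ren (ρ : ℕ → ℕ) : Srt → Srt
  | .atom Q => .atom (Q.ren ρ)
  | .pi S A T => .pi (S.ren ρ) (A.ren ρ) (T.ren (upRen ρ))
  | .top => .top
  | .inter S T => .inter (S.ren ρ) (T.ren ρ)

/-- Weakening by one new last variable. -/
def Atm.wk (R : Atm) : Atm := R.ren Nat.succ
/-- Weakening by one new last variable. -/
def Nrm.wk (N : Nrm) : Nrm := N.ren Nat.succ
/-- Weakening by one new last variable. -/
def Ty.wk (A : Ty) : Ty := A.ren Nat.succ
/-- Weakening by one new last variable. -/
def Srt.wk (S : Srt) : Srt := S.ren Nat.succ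

/-! ### η-expansion -/

/-- `η_a(R) = R` and `η_{α → β}(R) = λx. η_β(R (η_α(x)))`. -/
def expand : STy → Atm → Nrm
  | .base _, R => .atom R
  | .arr α β, R => .lam (expand β (.app R.wk (expand α (.var 0))))

/-! ### Hereditary substitution

`HSubst… N₀ k α₀ X Xr` is `[N₀/x₀]_{α₀} X = Xr` where `x₀` is the variable with index `k`. The
variable `x₀` does not exist in the scope of `N₀` and `Xr`, so indices above `k` drop by one. -/

mutual
/-- Substitution into atomic terms with head other than `x₀`, yielding an atomic term. -/
inductive HSubstRR : Nrm → ℕ → STy → Atm → Atm → Prop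
  | const (N₀ : Nrm) (k : ℕ) (α₀ : STy) (c : OConst) :
      HSubstRR N₀ k α₀ (.const c) (.const c)
  | varLt (N₀ : Nrm) (k : ℕ) (α₀ : STy) (i : ℕ) :
      i < k → HSubstRR N₀ k α₀ (.var i) (.var i)
  | varGt (N₀ : Nrm) (k : ℕ) (α₀ : STy) (i : ℕ) :
      k ≤ i → HSubstRR N₀ k α₀ (.var (i + 1)) (.var i)
  | app {N₀ : Nrm} {k : ℕ} {α₀ : STy} {R₁ Rr₁ : Atm} {N₂ Nr₂ : Nrm} :
      HSubstRR N₀ k α₀ R₁ Rr₁ → HSubstN N₀ k α₀ N₂ Nr₂ →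
      HSubstRR N₀ k α₀ (.app R₁ N₂) (.app Rr₁ Nr₂)
/-- Substitution into atomic terms with head `x₀`, yielding a normal term and its simple type. -/
inductive HSubstRN : Nrm → ℕ → STy → Atm → Nrm → STy → Prop
  | var (N₀ : Nrm) (k : ℕ) (α₀ : STy) : HSubstRN N₀ k α₀ (.var k) N₀ α₀
  | beta {N₀ : Nrm} {k : ℕ} {α₀ : STy} {R₁ : Atm} {N₁ Nr₁ N₂ Nr₂ : Nrm} {α₁ α₂ : STy} :
      HSubstRN N₀ k α₀ R₁ (.lam N₁) (.arr α₂ α₁) → HSubstN N₀ k α₀ N₂ Nr₂ →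
      HSubstN Nr₂ 0 α₂ N₁ Nr₁ →
      HSubstRN N₀ k α₀ (.app R₁ N₂) Nr₁ α₁
/-- Substitution into normal terms. -/
inductive HSubstN : Nrm → ℕ → STy → Nrm → Nrm → Prop
  | atom {N₀ : Nrm} {k : ℕ} {α₀ : STy} {R Rr : Atm} :
      HSubstRR N₀ k α₀ R Rr → HSubstN N₀ k α₀ (.atom R) (.atom Rr)
  | atomNorm {N₀ : Nrm} {k : ℕ} {α₀ : STy} {R Rr : Atm} {a : TConst} :
      HSubstRN N₀ k α₀ R (.atom Rr) (.base a) → HSubstN N₀ k α₀ (.atom R) (.atom Rr)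
  | lam {N₀ : Nrm} {k : ℕ} {α₀ : STy} {N Nr : Nrm} :
      HSubstN N₀.wk (k + 1) α₀ N Nr → HSubstN N₀ k α₀ (.lam N) (.lam Nr)
end

/-- Substitution into atomic type families. -/
inductive HSubstP : Nrm → ℕ → STy → ATy → ATy → Prop
  | const (N₀ : Nrm) (k : ℕ) (α₀ : STy) (a : TConst) :
      HSubstP N₀ k α₀ (.const a) (.const a)
  | app {N₀ : Nrm} {k : ℕ} {α₀ : STy} {P Pr : ATy} {N Nr : Nrm} :
      HSubstP N₀ k α₀ P Pr → HSubstN N₀ k α₀ N Nr →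
      HSubstP N₀ k α₀ (.app P N) (.app Pr Nr)

/-- Substitution into normal type families. -/
inductive HSubstA : Nrm → ℕ → STy → Ty → Ty → Prop
  | atom {N₀ : Nrm} {k : ℕ} {α₀ : STy} {P Pr : ATy} :
      HSubstP N₀ k α₀ P Pr → HSubstA N₀ k α₀ (.atom P) (.atom Pr)
  | pi {N₀ : Nrm} {k : ℕ} {α₀ : STy} {A Ar B Br : Ty} :
      HSubstA N₀ k α₀ A Ar → HSubstA N₀.wk (k + 1) α₀ B Br →
      HSubstA N₀ k α₀ (.pi A B) (.pi Ar Br)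

/-- Substitution into kinds. -/
inductive HSubstK : Nrm → ℕ → STy → Knd → Knd → Prop
  | type (N₀ : Nrm) (k : ℕ) (α₀ : STy) : HSubstK N₀ k α₀ .type .type
  | pi {N₀ : Nrm} {k : ℕ} {α₀ : STy} {A Ar : Ty} {K Kr : Knd} :
      HSubstA N₀ k α₀ A Ar → HSubstK N₀.wk (k + 1) α₀ K Kr →
      HSubstK N₀ k α₀ (.pi A K) (.pi Ar Kr)

/-- Substitution into atomic sort families. -/
inductive HSubstQ : Nrm → ℕ → STy → ASrt → ASrt → Prop
  | const (N₀ : Nrm) (k : ℕ) (α₀ : STy) (s : SConst) :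
      HSubstQ N₀ k α₀ (.const s) (.const s)
  | app {N₀ : Nrm} {k : ℕ} {α₀ : STy} {Q Qr : ASrt} {N Nr : Nrm} :
      HSubstQ N₀ k α₀ Q Qr → HSubstN N₀ k α₀ N Nr →
      HSubstQ N₀ k α₀ (.app Q N) (.app Qr Nr)

/-- Substitution into normal sort families. -/
inductive HSubstS : Nrm → ℕ → STy → Srt → Srt → Prop
  | atom {N₀ : Nrm} {k : ℕ} {α₀ : STy} {Q Qr : ASrt} :
      HSubstQ N₀ k α₀ Q Qr → HSubstS N₀ k α₀ (.atom Q) (.atom Qr)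
  | pi {N₀ : Nrm} {k : ℕ} {α₀ : STy} {S Sr T Tr : Srt} {A Ar : Ty} :
      HSubstS N₀ k α₀ S Sr → HSubstA N₀ k α₀ A Ar → HSubstS N₀.wk (k + 1) α₀ T Tr →
      HSubstS N₀ k α₀ (.pi S A T) (.pi Sr Ar Tr)
  | top (N₀ : Nrm) (k : ℕ) (α₀ : STy) : HSubstS N₀ k α₀ .top .top
  | inter {N₀ : Nrm} {k : ℕ} {α₀ : STy} {S₁ Sr₁ S₂ Sr₂ : Srt} :
      HSubstS N₀ k α₀ S₁ Sr₁ → HSubstS N₀ k α₀ S₂ Sr₂ →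
      HSubstS N₀ k α₀ (.inter S₁ S₂) (.inter Sr₁ Sr₂)

/-- Substitution into classes. -/
inductive HSubstL : Nrm → ℕ → STy → Cls → Cls → Prop
  | sort (N₀ : Nrm) (k : ℕ) (α₀ : STy) : HSubstL N₀ k α₀ .sort .sort
  | pi {N₀ : Nrm} {k : ℕ} {α₀ : STy} {S Sr : Srt} {A Ar : Ty} {L Lr : Cls} :
      HSubstS N₀ k α₀ S Sr → HSubstA N₀ k α₀ A Ar → HSubstL N₀.wk (k + 1) α₀ L Lr →
      HSubstL N₀ k α₀ (.pi S A L) (.pi Sr Ar Lr)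
  | top (N₀ : Nrm) (k : ℕ) (α₀ : STy) : HSubstL N₀ k α₀ .top .top
  | inter {N₀ : Nrm} {k : ℕ} {α₀ : STy} {L₁ Lr₁ L₂ Lr₂ : Cls} :
      HSubstL N₀ k α₀ L₁ Lr₁ → HSubstL N₀ k α₀ L₂ Lr₂ →
      HSubstL N₀ k α₀ (.inter L₁ L₂) (.inter Lr₁ Lr₂)

/-! ### Canonical LF -/

/-- `x : A ∈ Γ`, where `x` has the given index and `A` is read in the whole context `Γ`. -/
inductive LFLookup : LFCtx → ℕ → Ty → Prop
  | zero (Γ : LFCtx) (A : Ty) : LFLookup (A :: Γ) 0 A.wk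
  | succ {Γ : LFCtx} {i : ℕ} {A : Ty} (B : Ty) :
      LFLookup Γ i A → LFLookup (B :: Γ) (i + 1) A.wk

mutual
/-- LF synthesis `Γ ⊢ R ⇒ A`. -/
inductive LFSynth (Sg : LFSig) : LFCtx → Atm → Ty → Prop
  | const {Γ : LFCtx} {c : OConst} {A : Ty} :
      LFDecl.tm c A ∈ Sg → LFSynth Sg Γ (.const c) A
  | var {Γ : LFCtx} {i : ℕ} {A : Ty} : LFLookup Γ i A → LFSynth Sg Γ (.var i) A
  | app {Γ : LFCtx} {R : Atm} {N : Nrm} {A B Br : Ty} :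
      LFSynth Sg Γ R (.pi A B) → LFCheck Sg Γ N A → HSubstA N 0 A.erase B Br →
      LFSynth Sg Γ (.app R N) Br
/-- LF checking `Γ ⊢ N ⇐ A`. -/
inductive LFCheck (Sg : LFSig) : LFCtx → Nrm → Ty → Prop
  | atom {Γ : LFCtx} {R : Atm} {P : ATy} :
      LFSynth Sg Γ R (.atom P) → LFCheck Sg Γ (.atom R) (.atom P)
  | lam {Γ : LFCtx} {N : Nrm} {A B : Ty} :
      LFCheck Sg (A :: Γ) N B → LFCheck Sg Γ (.lam N) (.pi A B)
end

/-- Kind synthesis `Γ ⊢ P ⇒ K`. -/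
inductive LFKindSynth (Sg : LFSig) : LFCtx → ATy → Knd → Prop
  | const {Γ : LFCtx} {a : TConst} {K : Knd} :
      LFDecl.ty a K ∈ Sg → LFKindSynth Sg Γ (.const a) K
  | app {Γ : LFCtx} {P : ATy} {N : Nrm} {A : Ty} {K Kr : Knd} :
      LFKindSynth Sg Γ P (.pi A K) → LFCheck Sg Γ N A → HSubstK N 0 A.erase K Kr →
      LFKindSynth Sg Γ (.app P N) Kr

/-- Well-formed types `Γ ⊢ A ⇐ type`. -/
inductive LFTyOk (Sg : LFSig) : LFCtx → Ty → Prop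
  | atom {Γ : LFCtx} {P : ATy} : LFKindSynth Sg Γ P .type → LFTyOk Sg Γ (.atom P)
  | pi {Γ : LFCtx} {A B : Ty} :
      LFTyOk Sg Γ A → LFTyOk Sg (A :: Γ) B → LFTyOk Sg Γ (.pi A B)

/-- Well-formed kinds `Γ ⊢ K ⇐ kind`. -/
inductive LFKndOk (Sg : LFSig) : LFCtx → Knd → Prop
  | type (Γ : LFCtx) : LFKndOk Sg Γ .type
  | pi {Γ : LFCtx} {A : Ty} {K : Knd} :
      LFTyOk Sg Γ A → LFKndOk Sg (A :: Γ) K → LFKndOk Sg Γ (.pi A K)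

/-- Well-formed LF contexts. -/
inductive LFCtxOk (Sg : LFSig) : LFCtx → Prop
  | nil : LFCtxOk Sg []
  | cons {Γ : LFCtx} {A : Ty} : LFCtxOk Sg Γ → LFTyOk Sg Γ A → LFCtxOk Sg (A :: Γ)

/-! ### Refinements -/

/-- `x :: S ⊏ A ∈ Γ`, where `x` has the given index and `S`, `A` are read in all of `Γ`. -/
inductive Lookup : Ctx → ℕ → Srt → Ty → Prop
  | zero (Γ : Ctx) (S : Srt) (A : Ty) : Lookup ((S, A) :: Γ) 0 S.wk A.wk
  | succ {Γ : Ctx} {i : ℕ} {S : Srt} {A : Ty} (D : Srt × Ty) :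
      Lookup Γ i S A → Lookup (D :: Γ) (i + 1) S.wk A.wk

/-- One declared subsorting step `s₁ N₁ … Nₙ ≤ s₂ N₁ … Nₙ`, where `s₁ ≤ s₂ ∈ Σ`. -/
inductive SubStep (Sg : Sig) : ASrt → ASrt → Prop
  | const {s₁ s₂ : SConst} : Decl.sub s₁ s₂ ∈ Sg → SubStep Sg (.const s₁) (.const s₂)
  | app {Q₁ Q₂ : ASrt} (N : Nrm) :
      SubStep Sg Q₁ Q₂ → SubStep Sg (.app Q₁ N) (.app Q₂ N)

/-- Subsorting `Q₁ ≤ Q₂` on atomic sorts. -/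
inductive Subsort (Sg : Sig) : ASrt → ASrt → Prop
  | refl (Q : ASrt) : Subsort Sg Q Q
  | step {Q₁ Qr Q₂ : ASrt} : SubStep Sg Q₁ Qr → Subsort Sg Qr Q₂ → Subsort Sg Q₁ Q₂

mutual
/-- Sort synthesis `Γ ⊢ R ⇒ S`. -/
inductive Synth (Sg : Sig) : Ctx → Atm → Srt → Prop
  | const {Γ : Ctx} {c : OConst} {S : Srt} :
      Decl.tmSrt c S ∈ Sg → Synth Sg Γ (.const c) S
  | var {Γ : Ctx} {i : ℕ} {S : Srt} {A : Ty} : Lookup Γ i S A → Synth Sg Γ (.var i) S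
  | app {Γ : Ctx} {R : Atm} {N : Nrm} {S T Tr : Srt} {A : Ty} :
      Synth Sg Γ R (.pi S A T) → Check Sg Γ N S → HSubstS N 0 A.erase T Tr →
      Synth Sg Γ (.app R N) Tr
  | interLeft {Γ : Ctx} {R : Atm} {S₁ S₂ : Srt} :
      Synth Sg Γ R (.inter S₁ S₂) → Synth Sg Γ R S₁
  | interRight {Γ : Ctx} {R : Atm} {S₁ S₂ : Srt} :
      Synth Sg Γ R (.inter S₁ S₂) → Synth Sg Γ R S₂
/-- Sort checking `Γ ⊢ N ⇐ S`. -/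
inductive Check (Sg : Sig) : Ctx → Nrm → Srt → Prop
  | switch {Γ : Ctx} {R : Atm} {Qr Q : ASrt} :
      Synth Sg Γ R (.atom Qr) → Subsort Sg Qr Q → Check Sg Γ (.atom R) (.atom Q)
  | lam {Γ : Ctx} {N : Nrm} {S T : Srt} {A : Ty} :
      Check Sg ((S, A) :: Γ) N T → Check Sg Γ (.lam N) (.pi S A T)
  | top (Γ : Ctx) (N : Nrm) : Check Sg Γ N .top
  | inter {Γ : Ctx} {N : Nrm} {S₁ S₂ : Srt} :
      Check Sg Γ N S₁ → Check Sg Γ N S₂ → Check Sg Γ N (.inter S₁ S₂)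
end

/-- Class synthesis `Γ ⊢ Q ⊏ P ⇒ L`. -/
inductive ClsSynth (Sg : Sig) : Ctx → ASrt → ATy → Cls → Prop
  | const {Γ : Ctx} {s : SConst} {a : TConst} {L : Cls} :
      Decl.srt s a L ∈ Sg → ClsSynth Sg Γ (.const s) (.const a) L
  | app {Γ : Ctx} {Q : ASrt} {P : ATy} {N : Nrm} {S : Srt} {A : Ty} {L Lr : Cls} :
      ClsSynth Sg Γ Q P (.pi S A L) → Check Sg Γ N S → HSubstL N 0 A.erase L Lr →
      ClsSynth Sg Γ (.app Q N) (.app P N) Lr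
  | interLeft {Γ : Ctx} {Q : ASrt} {P : ATy} {L₁ L₂ : Cls} :
      ClsSynth Sg Γ Q P (.inter L₁ L₂) → ClsSynth Sg Γ Q P L₁
  | interRight {Γ : Ctx} {Q : ASrt} {P : ATy} {L₁ L₂ : Cls} :
      ClsSynth Sg Γ Q P (.inter L₁ L₂) → ClsSynth Sg Γ Q P L₂

/-- Sort formation `Γ ⊢ S ⊏ A`. -/
inductive SrtOk (Sg : Sig) : Ctx → Srt → Ty → Prop
  | atom {Γ : Ctx} {Q : ASrt} {P : ATy} :
      ClsSynth Sg Γ Q P .sort → SrtOk Sg Γ (.atom Q) (.atom P)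
  | pi {Γ : Ctx} {S T : Srt} {A B : Ty} :
      SrtOk Sg Γ S A → SrtOk Sg ((S, A) :: Γ) T B →
      SrtOk Sg Γ (.pi S A T) (.pi A B)
  | top (Γ : Ctx) (A : Ty) : SrtOk Sg Γ .top A
  | inter {Γ : Ctx} {S₁ S₂ : Srt} {A : Ty} :
      SrtOk Sg Γ S₁ A → SrtOk Sg Γ S₂ A → SrtOk Sg Γ (.inter S₁ S₂) A

/-- Class formation `Γ ⊢ L ⊏ K`. -/
inductive ClsOk (Sg : Sig) : Ctx → Cls → Knd → Prop
  | sort (Γ : Ctx) : ClsOk Sg Γ .sort .type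
  | pi {Γ : Ctx} {S : Srt} {A : Ty} {L : Cls} {K : Knd} :
      SrtOk Sg Γ S A → ClsOk Sg ((S, A) :: Γ) L K → ClsOk Sg Γ (.pi S A L) (.pi A K)
  | top (Γ : Ctx) (K : Knd) : ClsOk Sg Γ .top K
  | inter {Γ : Ctx} {L₁ L₂ : Cls} {K : Knd} :
      ClsOk Sg Γ L₁ K → ClsOk Sg Γ L₂ K → ClsOk Sg Γ (.inter L₁ L₂) K

/-- Well-formed contexts. -/
inductive CtxOk (Sg : Sig) : Ctx → Prop
  | nil : CtxOk Sg []
  | cons {Γ : Ctx} {S : Srt} {A : Ty} :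
      CtxOk Sg Γ → SrtOk Sg Γ S A → CtxOk Sg ((S, A) :: Γ)

/-- Well-formed signatures. -/
inductive SigOk : Sig → Prop
  | nil : SigOk []
  | ty {Sg : Sig} {a : TConst} {K : Knd} :
      SigOk Sg → LFKndOk (eraseSig Sg) [] K → (∀ Kr, Decl.ty a Kr ∉ Sg) →
      SigOk (.ty a K :: Sg)
  | tm {Sg : Sig} {c : OConst} {A : Ty} :
      SigOk Sg → LFTyOk (eraseSig Sg) [] A → (∀ Ar, Decl.tm c Ar ∉ Sg) →
      SigOk (.tm c A :: Sg)
  | srt {Sg : Sig} {s : SConst} {a : TConst} {L : Cls} {K : Knd} :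
      SigOk Sg → Decl.ty a K ∈ Sg → ClsOk Sg [] L K → (∀ ar Lr, Decl.srt s ar Lr ∉ Sg) →
      SigOk (.srt s a L :: Sg)
  | tmSrt {Sg : Sig} {c : OConst} {S : Srt} {A : Ty} :
      SigOk Sg → Decl.tm c A ∈ Sg → SrtOk Sg [] S A → (∀ Sr, Decl.tmSrt c Sr ∉ Sg) →
      SigOk (.tmSrt c S :: Sg)
  | sub {Sg : Sig} {s₁ s₂ : SConst} {a : TConst} {L : Cls} :
      SigOk Sg → Decl.srt s₁ a L ∈ Sg → Decl.srt s₂ a L ∈ Sg →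
      SigOk (.sub s₁ s₂ :: Sg)

end LFR

open LFR

namespace LFR

/-! ### Renamings -/

-- Expansion goes by induction on the simple type of `A`. At a Π-sort, `R` is weakened and applied
-- to the expanded bound variable, which checks by the induction hypothesis at the domain. The
-- application has sort `[η(x)/x]T`, so everything rests on this being `T` again.
--
-- That identity is proved for simply typed syntax, together with its dual `ExpandSubst`: if
-- substitution sends `R` to `N` of type `β`, it sends the expansion of `R` to `N`. The two are
-- interleaved by the size of simple types. Replacing `x : α` by its expansion uses the dual at
-- types smaller than `α`; the dual at `β₁ → β₂` uses the identity at `β₁` and itself at `β₂`.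
--
-- Terms inside sorts need not be typed, since anything checks against `⊤`. But `S ⊏ A` forces the
-- arguments and type annotations in `S` to be those of `A` (`Refines`), and `A` is well formed,
-- hence simply typed. So `Refines.hsubst` transports the identity from types to sorts. Identity is
-- Expansion applied to the newest variable.

theorem upRen_comp (ρ ξ : ℕ → ℕ) : upRen ρ ∘ upRen ξ = upRen (ρ ∘ ξ) := by
  funext i; cases i <;> rfl

theorem upRen_comp_succ (ρ : ℕ → ℕ) : upRen ρ ∘ Nat.succ = Nat.succ ∘ ρ := rfl

mutual
theorem Atm.ren_ren (ρ ξ : ℕ → ℕ) : ∀ R : Atm, (R.ren ξ).ren ρ = R.ren (ρ ∘ ξ)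
  | .const _ => rfl
  | .var _ => rfl
  | .app R N => by simp only [Atm.ren, Atm.ren_ren ρ ξ R, Nrm.ren_ren ρ ξ N]
theorem Nrm.ren_ren (ρ ξ : ℕ → ℕ) : ∀ N : Nrm, (N.ren ξ).ren ρ = N.ren (ρ ∘ ξ)
  | .atom R => by simp only [Nrm.ren, Atm.ren_ren ρ ξ R]
  | .lam N => by simp only [Nrm.ren, Nrm.ren_ren _ _ N, upRen_comp]
end

theorem ATy.ren_ren (ρ ξ : ℕ → ℕ) : ∀ P : ATy, (P.ren ξ).ren ρ = P.ren (ρ ∘ ξ)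
  | .const _ => rfl
  | .app P N => by simp only [ATy.ren, ATy.ren_ren ρ ξ P, Nrm.ren_ren]

theorem Ty.ren_ren (ρ ξ : ℕ → ℕ) (A : Ty) : (A.ren ξ).ren ρ = A.ren (ρ ∘ ξ) := by
  induction A generalizing ρ ξ with
  | atom P => simp only [Ty.ren, ATy.ren_ren]
  | pi A B ihA ihB => simp only [Ty.ren, ihA, ihB, upRen_comp]

theorem ASrt.ren_ren (ρ ξ : ℕ → ℕ) : ∀ Q : ASrt, (Q.ren ξ).ren ρ = Q.ren (ρ ∘ ξ)
  | .const _ => rfl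
  | .app Q N => by simp only [ASrt.ren, ASrt.ren_ren ρ ξ Q, Nrm.ren_ren]

theorem Srt.ren_ren (ρ ξ : ℕ → ℕ) (S : Srt) : (S.ren ξ).ren ρ = S.ren (ρ ∘ ξ) := by
  induction S generalizing ρ ξ with
  | atom Q => simp only [Srt.ren, ASrt.ren_ren]
  | pi S A T ihS ihT => simp only [Srt.ren, ihS, ihT, Ty.ren_ren, upRen_comp]
  | top => rfl
  | inter S T ihS ihT => simp only [Srt.ren, ihS, ihT]

theorem Atm.ren_wk (ρ : ℕ → ℕ) (R : Atm) : R.wk.ren (upRen ρ) = (R.ren ρ).wk := by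
  simp only [Atm.wk, Atm.ren_ren, upRen_comp_succ]

theorem Nrm.ren_wk (ρ : ℕ → ℕ) (N : Nrm) : N.wk.ren (upRen ρ) = (N.ren ρ).wk := by
  simp only [Nrm.wk, Nrm.ren_ren, upRen_comp_succ]

theorem Ty.ren_wk (ρ : ℕ → ℕ) (A : Ty) : A.wk.ren (upRen ρ) = (A.ren ρ).wk := by
  simp only [Ty.wk, Ty.ren_ren, upRen_comp_succ]

theorem Srt.ren_wk (ρ : ℕ → ℕ) (S : Srt) : S.wk.ren (upRen ρ) = (S.ren ρ).wk := by
  simp only [Srt.wk, Srt.ren_ren, upRen_comp_succ]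

theorem ATy.erase_ren (ρ : ℕ → ℕ) : ∀ P : ATy, (P.ren ρ).erase = P.erase
  | .const _ => rfl
  | .app P _ => ATy.erase_ren ρ P

theorem Ty.erase_ren (ρ : ℕ → ℕ) (A : Ty) : (A.ren ρ).erase = A.erase := by
  induction A generalizing ρ with
  | atom P => exact ATy.erase_ren ρ P
  | pi A B ihA ihB => simp only [Ty.ren, Ty.erase, ihA, ihB]

theorem Ty.erase_wk (A : Ty) : A.wk.erase = A.erase := A.erase_ren _

theorem expand_ren (ρ : ℕ → ℕ) (α : STy) (R : Atm) :
    (expand α R).ren ρ = expand α (R.ren ρ) := by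
  induction α generalizing ρ R with
  | base a => rfl
  | arr α β ihα ihβ =>
    simp only [expand, Nrm.ren, ihβ, Atm.ren, ihα, Atm.ren_wk, upRen]

-- Renamings that avoid one variable.

/-- The renaming that skips the variable `k`. -/
def skip (k i : ℕ) : ℕ := if i < k then i else i + 1

theorem skip_zero : skip 0 = Nat.succ := by funext i; simp [skip]

theorem upRen_skip (k : ℕ) : upRen (skip k) = skip (k + 1) := by
  funext i
  cases i with
  | zero => simp [upRen, skip]
  | succ i => simp only [upRen, skip, Nat.add_lt_add_iff_right]; split <;> rfl

/-- Weakening a term under one binder leaves index 0 alone and frees index 1. This is the shape in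
which codomains meet the substitution lemmas below. -/
theorem upRen_succ : upRen Nat.succ = skip 1 := by rw [← skip_zero, upRen_skip]

/-! ### Hereditary substitution and renaming -/

/-- `ρ` and `ξ` rename the source and target of a substitution for `k` into those of a
substitution for `l`. -/
def SubstRen (ρ ξ : ℕ → ℕ) (k l : ℕ) : Prop := ρ k = l ∧ ∀ i, ρ (skip k i) = skip l (ξ i)

theorem SubstRen.up {ρ ξ : ℕ → ℕ} {k l : ℕ} (h : SubstRen ρ ξ k l) :
    SubstRen (upRen ρ) (upRen ξ) (k + 1) (l + 1) := by
  refine ⟨by simp only [upRen, h.1], fun i => ?_⟩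
  rw [← upRen_skip, ← upRen_skip]
  cases i with
  | zero => rfl
  | succ i => simp only [upRen, h.2]

/-- Used where a binder is instantiated: β-steps and dependent application. -/
theorem SubstRen.zero (ξ : ℕ → ℕ) : SubstRen (upRen ξ) ξ 0 0 :=
  ⟨rfl, fun i => by simp only [skip_zero, Nat.succ_eq_add_one, upRen]⟩

theorem SubstRen.wk (k : ℕ) : SubstRen Nat.succ Nat.succ k (k + 1) := by
  refine ⟨rfl, fun i => ?_⟩
  rw [← upRen_skip]
  rfl

/-- Both rules for variables other than `k` undo `skip k`, so renaming proofs can treat them as one.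
-/
theorem HSubstRR.var_skip (N₀ : Nrm) (k : ℕ) (α₀ : STy) (i : ℕ) :
    HSubstRR N₀ k α₀ (.var (skip k i)) (.var i) := by
  unfold skip
  split
  · exact .varLt _ _ _ _ ‹_›
  · exact .varGt _ _ _ _ (by omega)

mutual
theorem HSubstRR.ren {N₀ : Nrm} {k l : ℕ} {α₀ : STy} {R Rr : Atm} {ρ ξ : ℕ → ℕ}
    (hρ : SubstRen ρ ξ k l) :
    HSubstRR N₀ k α₀ R Rr → HSubstRR (N₀.ren ξ) l α₀ (R.ren ρ) (Rr.ren ξ)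
  | .const _ _ _ c => .const _ _ _ c
  | .varLt _ _ _ i hi => by
      have h := hρ.2 i
      rw [skip, if_pos hi] at h
      simp only [Atm.ren, h]
      exact .var_skip _ _ _ _
  | .varGt _ _ _ i hi => by
      have h := hρ.2 i
      rw [skip, if_neg (by omega)] at h
      simp only [Atm.ren, h]
      exact .var_skip _ _ _ _
  | .app hR hN => .app (hR.ren hρ) (hN.ren hρ)
theorem HSubstRN.ren {N₀ : Nrm} {k l : ℕ} {α₀ : STy} {R : Atm} {Nr : Nrm} {α : STy}
    {ρ ξ : ℕ → ℕ} (hρ : SubstRen ρ ξ k l) :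
    HSubstRN N₀ k α₀ R Nr α → HSubstRN (N₀.ren ξ) l α₀ (R.ren ρ) (Nr.ren ξ) α
  | .var _ _ _ => by
      simp only [Atm.ren, hρ.1]
      exact .var _ _ _
  | .beta hR hN hb => .beta (hR.ren hρ) (hN.ren hρ) (hb.ren (.zero ξ))
theorem HSubstN.ren {N₀ : Nrm} {k l : ℕ} {α₀ : STy} {N Nr : Nrm} {ρ ξ : ℕ → ℕ}
    (hρ : SubstRen ρ ξ k l) :
    HSubstN N₀ k α₀ N Nr → HSubstN (N₀.ren ξ) l α₀ (N.ren ρ) (Nr.ren ξ)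
  | .atom hR => .atom (hR.ren hρ)
  | .atomNorm hR => .atomNorm (hR.ren hρ)
  | .lam hN => .lam (by
      have h := hN.ren hρ.up
      rwa [Nrm.ren_wk] at h)
end

theorem HSubstP.ren {N₀ : Nrm} {k l : ℕ} {α₀ : STy} {P Pr : ATy} {ρ ξ : ℕ → ℕ}
    (hρ : SubstRen ρ ξ k l) (h : HSubstP N₀ k α₀ P Pr) :
    HSubstP (N₀.ren ξ) l α₀ (P.ren ρ) (Pr.ren ξ) := by
  induction h with
  | const => exact .const _ _ _ _
  | app _ hN ih => exact .app ih (hN.ren hρ)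

theorem HSubstA.ren {N₀ : Nrm} {k l : ℕ} {α₀ : STy} {A Ar : Ty} {ρ ξ : ℕ → ℕ}
    (hρ : SubstRen ρ ξ k l) (h : HSubstA N₀ k α₀ A Ar) :
    HSubstA (N₀.ren ξ) l α₀ (A.ren ρ) (Ar.ren ξ) := by
  induction h generalizing l ρ ξ with
  | atom hP => exact .atom (hP.ren hρ)
  | pi _ _ ihA ihB =>
    have h := ihB hρ.up
    rw [Nrm.ren_wk] at h
    exact .pi (ihA hρ) h

theorem HSubstQ.ren {N₀ : Nrm} {k l : ℕ} {α₀ : STy} {Q Qr : ASrt} {ρ ξ : ℕ → ℕ}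
    (hρ : SubstRen ρ ξ k l) (h : HSubstQ N₀ k α₀ Q Qr) :
    HSubstQ (N₀.ren ξ) l α₀ (Q.ren ρ) (Qr.ren ξ) := by
  induction h with
  | const => exact .const _ _ _ _
  | app _ hN ih => exact .app ih (hN.ren hρ)

theorem HSubstS.ren {N₀ : Nrm} {k l : ℕ} {α₀ : STy} {S Sr : Srt} {ρ ξ : ℕ → ℕ}
    (hρ : SubstRen ρ ξ k l) (h : HSubstS N₀ k α₀ S Sr) :
    HSubstS (N₀.ren ξ) l α₀ (S.ren ρ) (Sr.ren ξ) := by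
  induction h generalizing l ρ ξ with
  | atom hQ => exact .atom (hQ.ren hρ)
  | pi _ hA _ ihS ihT =>
    have h := ihT hρ.up
    rw [Nrm.ren_wk] at h
    exact .pi (ihS hρ) (hA.ren hρ) h
  | top => exact .top _ _ _
  | inter _ _ ih₁ ih₂ => exact .inter (ih₁ hρ) (ih₂ hρ)

mutual
/-- Substitution for a variable that does not occur. -/
theorem HSubstRR.of_skip (N₀ : Nrm) (k : ℕ) (α₀ : STy) :
    ∀ R : Atm, HSubstRR N₀ k α₀ (R.ren (skip k)) R
  | .const c => .const _ _ _ c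
  | .var i => .var_skip _ _ _ i
  | .app R N => .app (HSubstRR.of_skip N₀ k α₀ R) (HSubstN.of_skip N₀ k α₀ N)
/-- Substitution for a variable that does not occur. -/
theorem HSubstN.of_skip (N₀ : Nrm) (k : ℕ) (α₀ : STy) :
    ∀ N : Nrm, HSubstN N₀ k α₀ (N.ren (skip k)) N
  | .atom R => .atom (HSubstRR.of_skip N₀ k α₀ R)
  | .lam N => .lam (by
      rw [upRen_skip]
      exact HSubstN.of_skip N₀.wk (k + 1) α₀ N)
end

theorem HSubstP.erase_eq {N₀ : Nrm} {k : ℕ} {α₀ : STy} {P Pr : ATy}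
    (h : HSubstP N₀ k α₀ P Pr) : Pr.erase = P.erase := by
  induction h with
  | const => rfl
  | app _ _ ih => exact ih

theorem HSubstA.erase_eq {N₀ : Nrm} {k : ℕ} {α₀ : STy} {A Ar : Ty}
    (h : HSubstA N₀ k α₀ A Ar) : Ar.erase = A.erase := by
  induction h with
  | atom hP => exact hP.erase_eq
  | pi _ _ ihA ihB => simp only [Ty.erase, ihA, ihB]

/-- Expansion keeps the head, so substitution stays compositional; the new bound variable has index
0, below `k + 1`, and is left alone. -/
theorem HSubstRR.expand {N₀ : Nrm} {k : ℕ} {α₀ : STy} {R Rr : Atm}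
    (h : HSubstRR N₀ k α₀ R Rr) (β : STy) :
    HSubstN N₀ k α₀ (expand β R) (expand β Rr) := by
  induction β generalizing N₀ k R Rr with
  | base a => exact .atom h
  | arr β₁ β₂ ih₁ ih₂ =>
    exact .lam (ih₂ (.app (h.ren (.wk k)) (ih₁ (.varLt _ _ _ _ k.succ_pos))))

/-! ### Simple typing -/

/-- The simple type `A⁻` of the term constant `c`. -/
def ConstSTy (Sg : LFSig) (c : OConst) (α : STy) : Prop := ∃ A, LFDecl.tm c A ∈ Sg ∧ A.erase = α

mutual
/-- Simple type synthesis of atomic terms. -/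
inductive SimpleSynth (Sg : LFSig) : List STy → Atm → STy → Prop
  | const {Ψ : List STy} {c : OConst} {α : STy} :
      ConstSTy Sg c α → SimpleSynth Sg Ψ (.const c) α
  | var {Ψ : List STy} {i : ℕ} {α : STy} : Ψ[i]? = some α → SimpleSynth Sg Ψ (.var i) α
  | app {Ψ : List STy} {R : Atm} {N : Nrm} {α β : STy} :
      SimpleSynth Sg Ψ R (.arr α β) → SimpleCheck Sg Ψ N α → SimpleSynth Sg Ψ (.app R N) β
/-- Simple type checking of normal terms; atomic terms are checked only at base types. -/
inductive SimpleCheck (Sg : LFSig) : List STy → Nrm → STy → Prop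
  | atom {Ψ : List STy} {R : Atm} {a : TConst} :
      SimpleSynth Sg Ψ R (.base a) → SimpleCheck Sg Ψ (.atom R) (.base a)
  | lam {Ψ : List STy} {N : Nrm} {α β : STy} :
      SimpleCheck Sg (α :: Ψ) N β → SimpleCheck Sg Ψ (.lam N) (.arr α β)
end

/-- Atomic type families all of whose arguments are simply typed. -/
inductive SimpleATy (Sg : LFSig) (Ψ : List STy) : ATy → Prop
  | const (a : TConst) : SimpleATy Sg Ψ (.const a)
  | app {P : ATy} {N : Nrm} {α : STy} :
      SimpleATy Sg Ψ P → SimpleCheck Sg Ψ N α → SimpleATy Sg Ψ (.app P N)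

/-- Types all of whose terms are simply typed. -/
inductive SimpleTy (Sg : LFSig) : List STy → Ty → Prop
  | atom {Ψ : List STy} {P : ATy} : SimpleATy Sg Ψ P → SimpleTy Sg Ψ (.atom P)
  | pi {Ψ : List STy} {A B : Ty} :
      SimpleTy Sg Ψ A → SimpleTy Sg (A.erase :: Ψ) B → SimpleTy Sg Ψ (.pi A B)

theorem ATy.exists_erase_eq_base : ∀ P : ATy, ∃ a, P.erase = .base a
  | .const a => ⟨a, rfl⟩
  | .app P _ => P.exists_erase_eq_base

theorem LFLookup.getElem?_erase {Γ : LFCtx} {i : ℕ} {A : Ty} (h : LFLookup Γ i A) :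
    (Γ.map Ty.erase)[i]? = some A.erase := by
  induction h with
  | zero => simp [Ty.erase_wk]
  | succ _ _ ih => simpa [Ty.erase_wk] using ih

mutual
-- Substitution does not change the erasure of a type, so dependent application erases to simple
-- application.
theorem LFSynth.simple {Sg : LFSig} {Γ : LFCtx} {R : Atm} {A : Ty} :
    LFSynth Sg Γ R A → SimpleSynth Sg (Γ.map Ty.erase) R A.erase
  | .const h => .const ⟨_, h, rfl⟩
  | .var h => .var h.getElem?_erase
  | .app hR hN hB => by
      rw [hB.erase_eq]
      exact .app hR.simple hN.simple
theorem LFCheck.simple {Sg : LFSig} {Γ : LFCtx} {N : Nrm} {A : Ty} :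
    LFCheck Sg Γ N A → SimpleCheck Sg (Γ.map Ty.erase) N A.erase
  | .atom (P := P) hR => by
      obtain ⟨a, ha⟩ := P.exists_erase_eq_base
      have h := hR.simple
      simp only [Ty.erase, ha] at h ⊢
      exact .atom h
  | .lam hN => .lam hN.simple
end

theorem LFKindSynth.simple {Sg : LFSig} {Γ : LFCtx} {P : ATy} {K : Knd}
    (h : LFKindSynth Sg Γ P K) : SimpleATy Sg (Γ.map Ty.erase) P := by
  induction h with
  | const => exact .const _
  | app _ hN _ ih => exact .app ih hN.simple

theorem LFTyOk.simple {Sg : LFSig} {Γ : LFCtx} {A : Ty} (h : LFTyOk Sg Γ A) :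
    SimpleTy Sg (Γ.map Ty.erase) A := by
  induction h with
  | atom hP => exact .atom hP.simple
  | pi _ _ ihA ihB => exact .pi ihA ihB

-- Renaming of simply typed syntax.

/-- `ρ` maps the variables of `Ψ` to variables of `Ψr` with the same simple types. -/
def SimpleRen (ρ : ℕ → ℕ) (Ψ Ψr : List STy) : Prop :=
  ∀ i α, Ψ[i]? = some α → Ψr[ρ i]? = some α

theorem SimpleRen.up {ρ : ℕ → ℕ} {Ψ Ψr : List STy} (h : SimpleRen ρ Ψ Ψr) (β : STy) :
    SimpleRen (upRen ρ) (β :: Ψ) (β :: Ψr)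
  | 0, _, hi => hi
  | i + 1, α, hi => h i α hi

mutual
theorem SimpleSynth.ren {Sg : LFSig} {Ψ Ψr : List STy} {ρ : ℕ → ℕ} {R : Atm} {α : STy}
    (hρ : SimpleRen ρ Ψ Ψr) : SimpleSynth Sg Ψ R α → SimpleSynth Sg Ψr (R.ren ρ) α
  | .const h => .const h
  | .var h => .var (hρ _ _ h)
  | .app hR hN => .app (hR.ren hρ) (hN.ren hρ)
theorem SimpleCheck.ren {Sg : LFSig} {Ψ Ψr : List STy} {ρ : ℕ → ℕ} {N : Nrm} {α : STy}
    (hρ : SimpleRen ρ Ψ Ψr) : SimpleCheck Sg Ψ N α → SimpleCheck Sg Ψr (N.ren ρ) α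
  | .atom hR => .atom (hR.ren hρ)
  | .lam hN => .lam (hN.ren (hρ.up _))
end

theorem SimpleATy.ren {Sg : LFSig} {Ψ Ψr : List STy} {ρ : ℕ → ℕ} {P : ATy}
    (hρ : SimpleRen ρ Ψ Ψr) (h : SimpleATy Sg Ψ P) : SimpleATy Sg Ψr (P.ren ρ) := by
  induction h with
  | const => exact .const _
  | app _ hN ih => exact .app ih (hN.ren hρ)

theorem SimpleTy.ren {Sg : LFSig} {Ψ Ψr : List STy} {ρ : ℕ → ℕ} {A : Ty}
    (hρ : SimpleRen ρ Ψ Ψr) (h : SimpleTy Sg Ψ A) : SimpleTy Sg Ψr (A.ren ρ) := by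
  induction h generalizing ρ Ψr with
  | atom hP => exact .atom (hP.ren hρ)
  | pi _ _ ihA ihB =>
    refine .pi (ihA hρ) (ihB ?_)
    rw [Ty.erase_ren]
    exact hρ.up _

theorem SimpleTy.wk {Sg : LFSig} {Ψ : List STy} {A : Ty} (h : SimpleTy Sg Ψ A) (β : STy) :
    SimpleTy Sg (β :: Ψ) A.wk := h.ren fun _ _ hi => hi

mutual
theorem SimpleSynth.ren_eq_self {Sg : LFSig} {Ψ : List STy} {ρ : ℕ → ℕ} {R : Atm} {α : STy}
    (hρ : ∀ i < Ψ.length, ρ i = i) : SimpleSynth Sg Ψ R α → R.ren ρ = R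
  | .const _ => rfl
  | .var h => by simp only [Atm.ren, hρ _ (List.getElem?_eq_some_iff.1 h).1]
  | .app hR hN => by simp only [Atm.ren, hR.ren_eq_self hρ, hN.ren_eq_self hρ]
theorem SimpleCheck.ren_eq_self {Sg : LFSig} {Ψ : List STy} {ρ : ℕ → ℕ} {N : Nrm} {α : STy}
    (hρ : ∀ i < Ψ.length, ρ i = i) : SimpleCheck Sg Ψ N α → N.ren ρ = N
  | .atom hR => by simp only [Nrm.ren, hR.ren_eq_self hρ]
  | .lam hN => by
      rw [Nrm.ren, hN.ren_eq_self]
      rintro (_ | i) hi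
      · rfl
      · simp only [upRen, hρ i (Nat.lt_of_succ_lt_succ hi)]
end

theorem SimpleATy.ren_eq_self {Sg : LFSig} {Ψ : List STy} {ρ : ℕ → ℕ} {P : ATy}
    (hρ : ∀ i < Ψ.length, ρ i = i) (h : SimpleATy Sg Ψ P) : P.ren ρ = P := by
  induction h with
  | const => rfl
  | app _ hN ih => simp only [ATy.ren, ih, hN.ren_eq_self hρ]

/-- With `Ψ` empty this says that closed types are fixed by every renaming. -/
theorem SimpleTy.ren_eq_self {Sg : LFSig} {Ψ : List STy} {ρ : ℕ → ℕ} {A : Ty}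
    (hρ : ∀ i < Ψ.length, ρ i = i) (h : SimpleTy Sg Ψ A) : A.ren ρ = A := by
  induction h generalizing ρ with
  | atom hP => simp only [Ty.ren, hP.ren_eq_self hρ]
  | pi _ _ ihA ihB =>
    rw [Ty.ren, ihA hρ, ihB]
    rintro (_ | i) hi
    · rfl
    · simp only [upRen, hρ i (Nat.lt_of_succ_lt_succ hi)]

/-! ### Substitution of η-expanded variables -/

/-- The number of arrows in a simple type. -/
def STy.size : STy → ℕ
  | .base _ => 0
  | .arr α β => α.size + β.size + 1

/-- Substitution into the η-expansion at `β` of an atomic term whose head is substituted. -/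
def ExpandSubst (Sg : LFSig) (β : STy) : Prop :=
  ∀ (Ψ : List STy) (N₀ : Nrm) (k : ℕ) (α₀ : STy) (R : Atm) (N : Nrm),
    HSubstRN N₀ k α₀ R N β → SimpleCheck Sg Ψ N β → HSubstN N₀ k α₀ (expand β R) N

mutual
/-- Substituting `η_α(x)` for a variable of type `α` in `R : β` gives `R`, or its η-expansion if
the variable is the head of `R`. -/
theorem SimpleSynth.hsubst_expand_var {Sg : LFSig} {α : STy}
    (ih : ∀ β : STy, β.size < α.size → ExpandSubst Sg β) {Ψ : List STy} {k : ℕ}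
    {R : Atm} {β : STy} (hk : Ψ[k]? = some α) :
    SimpleSynth Sg Ψ R β →
      HSubstRR (expand α (.var k)) k α (R.ren (skip (k + 1))) R ∨
      HSubstRN (expand α (.var k)) k α (R.ren (skip (k + 1))) (expand β R) β ∧
        β.size ≤ α.size
  | .const _ => .inl (.const _ _ _ _)
  | .var (i := i) hi => by
      rcases lt_trichotomy i k with h | rfl | h
      · refine .inl ?_
        rw [Atm.ren, skip, if_pos (by omega)]
        exact .varLt _ _ _ _ h
      -- The head is the substituted variable itself; the size bound starts here as an equality and
      -- shrinks with each application.
      · refine .inr ?_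
        obtain rfl : α = β := Option.some.inj (hk.symm.trans hi)
        rw [Atm.ren, skip, if_pos (by omega)]
        exact ⟨.var _ _ _, le_rfl⟩
      · refine .inl ?_
        rw [Atm.ren, skip, if_neg (by omega)]
        exact .varGt _ _ _ _ h.le
  | .app (R := R) (α := α₂) hR hN => by
      have hN' := hN.hsubst_expand_var ih hk
      rcases hR.hsubst_expand_var ih hk with h | ⟨h, hle⟩
      · exact .inl (.app h hN')
      -- The bound on the size of `α₂ → β` makes `α₂` strictly smaller than `α`, so `ih` applies to
      -- the argument type.
      · simp only [STy.size] at hle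
        -- The λ produced for `R` has body `η(R y)` with `y` expanded. Substituting `N` for `y`
        -- leaves `R` fixed, as `y` is not in it, and turns the expanded `y` into `N`.
        refine .inr ⟨.beta h hN' (HSubstRR.expand (.app ?_ ?_) _), by omega⟩
        · rw [Atm.wk, ← skip_zero]
          exact .of_skip _ _ _ _
        · exact ih α₂ (by omega) _ _ _ _ _ _ (.var _ _ _) hN
/-- Substituting `η_α(x)` for a variable of type `α` in a simply typed normal term amounts to a
renaming. The source term is the image of `N`, whose variable `k` is split into `k` (to be
substituted) and `k + 1` (the variable `x`). -/
theorem SimpleCheck.hsubst_expand_var {Sg : LFSig} {α : STy}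
    (ih : ∀ β : STy, β.size < α.size → ExpandSubst Sg β) {Ψ : List STy} {k : ℕ}
    {N : Nrm} {β : STy} (hk : Ψ[k]? = some α) :
    SimpleCheck Sg Ψ N β →
      HSubstN (expand α (.var k)) k α (N.ren (skip (k + 1))) N
  | .atom hR => by
      rcases hR.hsubst_expand_var ih hk with h | ⟨h, -⟩
      · exact .atom h
      -- At a base type expansion does nothing, so the result is atomic as the rule demands.
      · exact .atomNorm h
  | .lam (α := γ) hN => by
      have h := hN.hsubst_expand_var (k := k + 1) ih hk
      rw [Nrm.ren, upRen_skip]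
      refine .lam ?_
      rw [Nrm.wk, expand_ren]
      exact h
end

/-- Strong induction on size closes the loop: `hsubst_expand_var` at the domain needs only types
still smaller than that domain. -/
theorem expandSubst (Sg : LFSig) (β : STy) : ExpandSubst Sg β := by
  induction hn : β.size using Nat.strong_induction_on generalizing β with
  | _ n ih =>
    subst hn
    intro Ψ N₀ k α₀ R N hR hN
    -- Simple typing makes `N` η-long: atomic at a base type, a λ at an arrow.
    cases hN with
    | atom _ => exact .atomNorm hR
    | @lam _ N' β₁ β₂ hN' =>
      have h₁ : β₁.size < (STy.arr β₁ β₂).size := by simp only [STy.size]; omega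
      have h₂ : β₂.size < (STy.arr β₁ β₂).size := by simp only [STy.size]; omega
      -- The weakened `R` yields a λ, which is β-reduced against the expanded bound variable. This
      -- returns `N'`, by the identity at `β₁`; the hypothesis at `β₂` then finishes.
      refine .lam (ih _ h₂ β₂ rfl _ _ _ _ _ _ (.beta (hR.ren (.wk k))
        (HSubstRR.expand (.varLt _ _ _ _ k.succ_pos) _) ?_) hN')
      rw [upRen_succ]
      exact hN'.hsubst_expand_var (k := 0) (fun γ hγ => ih _ (hγ.trans h₁) γ rfl) rfl

theorem SimpleATy.hsubst_expand_var {Sg : LFSig} {Ψ : List STy} {k : ℕ} {α : STy} {P : ATy}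
    (hk : Ψ[k]? = some α) (h : SimpleATy Sg Ψ P) :
    HSubstP (expand α (.var k)) k α (P.ren (skip (k + 1))) P := by
  induction h with
  | const => exact .const _ _ _ _
  | app _ hN ih => exact .app ih (hN.hsubst_expand_var (fun β _ => expandSubst Sg β) hk)

theorem SimpleTy.hsubst_expand_var {Sg : LFSig} {Ψ : List STy} {k : ℕ} {α : STy} {A : Ty}
    (hk : Ψ[k]? = some α) (h : SimpleTy Sg Ψ A) :
    HSubstA (expand α (.var k)) k α (A.ren (skip (k + 1))) A := by
  induction h generalizing k with
  | atom hP => exact .atom (hP.hsubst_expand_var hk)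
  | pi _ _ ihA ihB =>
    refine .pi (ihA hk) ?_
    rw [upRen_skip, Nrm.wk, expand_ren]
    exact ihB hk

/-! ### Structural refinement -/

/-- `Q` and `P` have the same arguments. -/
inductive SameArgs : ASrt → ATy → Prop
  | const (s : SConst) (a : TConst) : SameArgs (.const s) (.const a)
  | app {Q : ASrt} {P : ATy} (N : Nrm) : SameArgs Q P → SameArgs (.app Q N) (.app P N)

/-- The structural part of the sort formation judgment `S ⊏ A`. -/
inductive Refines : Srt → Ty → Prop
  | atom {Q : ASrt} {P : ATy} : SameArgs Q P → Refines (.atom Q) (.atom P)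
  | pi {S T : Srt} {A B : Ty} : Refines S A → Refines T B → Refines (.pi S A T) (.pi A B)
  | top (A : Ty) : Refines .top A
  | inter {S₁ S₂ : Srt} {A : Ty} : Refines S₁ A → Refines S₂ A → Refines (.inter S₁ S₂) A

theorem ClsSynth.sameArgs {Sg : Sig} {Γ : Ctx} {Q : ASrt} {P : ATy} {L : Cls}
    (h : ClsSynth Sg Γ Q P L) : SameArgs Q P := by
  induction h with
  | const => exact .const _ _
  | app _ _ _ ih => exact .app _ ih
  | interLeft _ ih => exact ih
  | interRight _ ih => exact ih

theorem SrtOk.refines {Sg : Sig} {Γ : Ctx} {S : Srt} {A : Ty} (h : SrtOk Sg Γ S A) :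
    Refines S A := by
  induction h with
  | atom hQ => exact .atom hQ.sameArgs
  | pi _ _ ihS ihT => exact .pi ihS ihT
  | top => exact .top _
  | inter _ _ ih₁ ih₂ => exact .inter ih₁ ih₂

theorem SameArgs.ren {Q : ASrt} {P : ATy} (h : SameArgs Q P) (ρ : ℕ → ℕ) :
    SameArgs (Q.ren ρ) (P.ren ρ) := by
  induction h with
  | const => exact .const _ _
  | app _ _ ih => exact .app _ ih

theorem Refines.ren {S : Srt} {A : Ty} (h : Refines S A) (ρ : ℕ → ℕ) :
    Refines (S.ren ρ) (A.ren ρ) := by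
  induction h generalizing ρ with
  | atom hQ => exact .atom (hQ.ren ρ)
  | pi _ _ ihS ihT => exact .pi (ihS ρ) (ihT _)
  | top => exact .top _
  | inter _ _ ih₁ ih₂ => exact .inter (ih₁ ρ) (ih₂ ρ)

theorem SameArgs.ren_eq_self {Q : ASrt} {P : ATy} (h : SameArgs Q P) {ρ : ℕ → ℕ}
    (hP : P.ren ρ = P) : Q.ren ρ = Q := by
  induction h with
  | const => rfl
  | app N _ ih =>
    simp only [ATy.ren, ATy.app.injEq] at hP
    simp only [ASrt.ren, ih hP.1, hP.2]

/-- Every term and type annotation in `S` already occurs in `A`, so what fixes `A` fixes `S`. -/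
theorem Refines.ren_eq_self {S : Srt} {A : Ty} (h : Refines S A) {ρ : ℕ → ℕ}
    (hA : A.ren ρ = A) : S.ren ρ = S := by
  induction h generalizing ρ with
  | atom hQ =>
    simp only [Ty.ren, Ty.atom.injEq] at hA
    simp only [Srt.ren, hQ.ren_eq_self hA]
  | pi _ _ ihS ihT =>
    simp only [Ty.ren, Ty.pi.injEq] at hA
    simp only [Srt.ren, ihS hA.1, ihT hA.2, hA.1]
  | top => rfl
  | inter _ _ ih₁ ih₂ => simp only [Srt.ren, ih₁ hA, ih₂ hA]

theorem SameArgs.hsubst {Q : ASrt} {P : ATy} (h : SameArgs Q P) {N₀ : Nrm} {k : ℕ} {α₀ : STy}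
    {ρ : ℕ → ℕ} (hP : HSubstP N₀ k α₀ (P.ren ρ) P) : HSubstQ N₀ k α₀ (Q.ren ρ) Q := by
  induction h with
  | const => exact .const _ _ _ _
  | app N _ ih =>
    cases hP with
    | app hP hN => exact .app (ih hP) hN

/-- The substitution derivation for `A` contains one for each argument of `S`, so no typing of the
sort's own terms is needed. -/
theorem Refines.hsubst {S : Srt} {A : Ty} (h : Refines S A) {N₀ : Nrm} {k : ℕ} {α₀ : STy}
    {ρ : ℕ → ℕ} (hA : HSubstA N₀ k α₀ (A.ren ρ) A) : HSubstS N₀ k α₀ (S.ren ρ) S := by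
  induction h generalizing N₀ k ρ with
  | atom hQ =>
    cases hA with
    | atom hP => exact .atom (hQ.hsubst hP)
  | pi _ _ ihS ihT =>
    cases hA with
    | pi hA hB => exact .pi (ihS hA) hA (ihT hB)
  | top => exact .top _ _ _
  | inter _ _ ih₁ ih₂ => exact .inter (ih₁ hA) (ih₂ hA)

/-! ### Closed signatures and weakening -/

/-- The types of term constants are closed. -/
def ClosedLFSig (Sg : LFSig) : Prop := ∀ c A, LFDecl.tm c A ∈ Sg → ∀ ρ, A.ren ρ = A

/-- The sorts of term constants are closed. -/
def ClosedSig (Sg : Sig) : Prop := ∀ c S, Decl.tmSrt c S ∈ Sg → ∀ ρ, S.ren ρ = S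

theorem mem_eraseSig_tm {Sg : Sig} {c : OConst} {A : Ty} :
    LFDecl.tm c A ∈ eraseSig Sg ↔ Decl.tm c A ∈ Sg := by
  simp only [eraseSig, List.mem_filterMap]
  constructor
  · rintro ⟨D, hD, h⟩
    cases D <;> simp_all [Decl.eraseRefs]
  · exact fun h => ⟨_, h, rfl⟩

theorem SigOk.tm_closed {Sg : Sig} (h : SigOk Sg) {c : OConst} {A : Ty}
    (hc : Decl.tm c A ∈ Sg) (ρ : ℕ → ℕ) : A.ren ρ = A := by
  induction h with
  | nil => simp at hc
  | tm _ hA _ ih =>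
    rcases List.mem_cons.1 hc with hc | hc
    · cases hc
      exact hA.simple.ren_eq_self (by simp)
    · exact ih hc
  | ty _ _ _ ih => exact ih (by simpa using hc)
  | srt _ _ _ _ ih => exact ih (by simpa using hc)
  | tmSrt _ _ _ _ ih => exact ih (by simpa using hc)
  | sub _ _ _ ih => exact ih (by simpa using hc)

theorem SigOk.closedLFSig {Sg : Sig} (h : SigOk Sg) : ClosedLFSig (eraseSig Sg) :=
  fun _ _ hc ρ => h.tm_closed (mem_eraseSig_tm.1 hc) ρ

/-- A constant's sort refines its closed type and inherits closedness. Weakening needs this, as the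
rule for constants does not shift the declared sort. -/
theorem SigOk.closedSig {Sg : Sig} (h : SigOk Sg) : ClosedSig Sg := by
  intro c S hc ρ
  induction h with
  | nil => simp at hc
  | tmSrt hSg hA hS _ ih =>
    rcases List.mem_cons.1 hc with hc | hc
    · cases hc
      exact hS.refines.ren_eq_self (hSg.tm_closed hA ρ)
    · exact ih hc
  | ty _ _ _ ih => exact ih (by simpa using hc)
  | tm _ _ _ ih => exact ih (by simpa using hc)
  | srt _ _ _ _ ih => exact ih (by simpa using hc)
  | sub _ _ _ ih => exact ih (by simpa using hc)

-- Well-typed renamings and weakening.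

/-- `ρ` is a well-typed renaming between LF contexts. -/
def LFRen (ρ : ℕ → ℕ) (Γ Γr : LFCtx) : Prop :=
  ∀ i A, LFLookup Γ i A → LFLookup Γr (ρ i) (A.ren ρ)

theorem LFRen.up {ρ : ℕ → ℕ} {Γ Γr : LFCtx} (h : LFRen ρ Γ Γr) (B : Ty) :
    LFRen (upRen ρ) (B :: Γ) (B.ren ρ :: Γr) := by
  intro i A hi
  cases hi with
  | zero =>
    rw [Ty.ren_wk]
    exact .zero _ _
  | succ _ hi =>
    rw [Ty.ren_wk]
    exact .succ _ (h _ _ hi)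

mutual
theorem LFSynth.ren {Sg : LFSig} (hSg : ClosedLFSig Sg) {Γ Γr : LFCtx} {ρ : ℕ → ℕ} {R : Atm}
    {A : Ty} (hρ : LFRen ρ Γ Γr) : LFSynth Sg Γ R A → LFSynth Sg Γr (R.ren ρ) (A.ren ρ)
  | .const h => .const (by rwa [hSg _ _ h])
  | .var h => .var (hρ _ _ h)
  | .app hR hN hB => .app (hR.ren hSg hρ) (hN.ren hSg hρ) (by
      rw [Ty.erase_ren]
      exact hB.ren (.zero ρ))
theorem LFCheck.ren {Sg : LFSig} (hSg : ClosedLFSig Sg) {Γ Γr : LFCtx} {ρ : ℕ → ℕ} {N : Nrm}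
    {A : Ty} (hρ : LFRen ρ Γ Γr) : LFCheck Sg Γ N A → LFCheck Sg Γr (N.ren ρ) (A.ren ρ)
  | .atom hR => .atom (hR.ren hSg hρ)
  | .lam hN => .lam (hN.ren hSg (hρ.up _))
end

theorem LFSynth.wk {Sg : LFSig} (hSg : ClosedLFSig Sg) {Γ : LFCtx} {R : Atm} {A : Ty}
    (h : LFSynth Sg Γ R A) (B : Ty) : LFSynth Sg (B :: Γ) R.wk A.wk :=
  h.ren hSg fun _ _ hi => .succ B hi

/-- `ρ` is a well-sorted renaming between contexts. -/
def CtxRen (ρ : ℕ → ℕ) (Γ Γr : Ctx) : Prop :=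
  ∀ i S A, Lookup Γ i S A → Lookup Γr (ρ i) (S.ren ρ) (A.ren ρ)

theorem CtxRen.up {ρ : ℕ → ℕ} {Γ Γr : Ctx} (h : CtxRen ρ Γ Γr) (S : Srt) (A : Ty) :
    CtxRen (upRen ρ) ((S, A) :: Γ) ((S.ren ρ, A.ren ρ) :: Γr) := by
  intro i T B hi
  cases hi with
  | zero =>
    rw [Ty.ren_wk, Srt.ren_wk]
    exact .zero _ _ _
  | succ _ hi =>
    rw [Ty.ren_wk, Srt.ren_wk]
    exact .succ _ (h _ _ _ hi)

theorem SubStep.ren {Sg : Sig} {Q₁ Q₂ : ASrt} (h : SubStep Sg Q₁ Q₂) (ρ : ℕ → ℕ) :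
    SubStep Sg (Q₁.ren ρ) (Q₂.ren ρ) := by
  induction h with
  | const h => exact .const h
  | app _ _ ih => exact .app _ ih

theorem Subsort.ren {Sg : Sig} {Q₁ Q₂ : ASrt} (h : Subsort Sg Q₁ Q₂) (ρ : ℕ → ℕ) :
    Subsort Sg (Q₁.ren ρ) (Q₂.ren ρ) := by
  induction h with
  | refl => exact .refl _
  | step h _ ih => exact .step (h.ren ρ) ih

mutual
theorem Synth.ren {Sg : Sig} (hSg : ClosedSig Sg) {Γ Γr : Ctx} {ρ : ℕ → ℕ} {R : Atm} {S : Srt}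
    (hρ : CtxRen ρ Γ Γr) : Synth Sg Γ R S → Synth Sg Γr (R.ren ρ) (S.ren ρ)
  | .const h => .const (by rwa [hSg _ _ h])
  | .var h => .var (hρ _ _ _ h)
  | .app (A := A) hR hN hT => .app (A := A.ren ρ) (hR.ren hSg hρ) (hN.ren hSg hρ) (by
      rw [Ty.erase_ren]
      exact hT.ren (.zero ρ))
  | .interLeft h => .interLeft (h.ren hSg hρ)
  | .interRight h => .interRight (h.ren hSg hρ)
theorem Check.ren {Sg : Sig} (hSg : ClosedSig Sg) {Γ Γr : Ctx} {ρ : ℕ → ℕ} {N : Nrm} {S : Srt}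
    (hρ : CtxRen ρ Γ Γr) : Check Sg Γ N S → Check Sg Γr (N.ren ρ) (S.ren ρ)
  | .switch hR hQ => .switch (hR.ren hSg hρ) (hQ.ren ρ)
  | .lam hN => .lam (hN.ren hSg (hρ.up _ _))
  | .top _ _ => .top _ _
  | .inter h₁ h₂ => .inter (h₁.ren hSg hρ) (h₂.ren hSg hρ)
end

theorem Synth.wk {Sg : Sig} (hSg : ClosedSig Sg) {Γ : Ctx} {R : Atm} {S : Srt}
    (h : Synth Sg Γ R S) (D : Srt × Ty) : Synth Sg (D :: Γ) R.wk S.wk :=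
  h.ren hSg fun _ _ _ hi => .succ D hi

/-! ### Expansion -/

/-- The case met in expansion: a codomain, weakened under its binder, is instantiated with the
expanded new variable. -/
theorem SimpleTy.hsubst_expand_zero {Sg : LFSig} {Ψ : List STy} {α : STy} {A : Ty}
    (h : SimpleTy Sg (α :: Ψ) A) :
    HSubstA (expand α (.var 0)) 0 α (A.ren (upRen Nat.succ)) A := by
  rw [upRen_succ]
  exact h.hsubst_expand_var (k := 0) rfl

theorem LFSynth.check_expand {Sg : LFSig} (hSg : ClosedLFSig Sg) {Γ : LFCtx} {A : Ty}
    (hA : SimpleTy Sg (Γ.map Ty.erase) A) {R : Atm} (hR : LFSynth Sg Γ R A) :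
    LFCheck Sg Γ (expand A.erase R) A := by
  induction hα : A.erase generalizing Γ A R with
  | base a =>
    cases A with
    | atom P => exact .atom hR
    | pi A B => simp [Ty.erase] at hα
  | arr α β ihα ihβ =>
    cases hA with
    | @atom _ P _ =>
      obtain ⟨a, ha⟩ := P.exists_erase_eq_base
      simp [Ty.erase, ha] at hα
    | @pi _ A B hA hB =>
      simp only [Ty.erase, STy.arr.injEq] at hα
      obtain ⟨rfl, rfl⟩ := hα
      refine .lam (ihβ (Γ := A :: Γ) hB (.app (hR.wk hSg A)
        (ihα (Γ := A :: Γ) (hA.wk _) (.var (.zero Γ A)) A.erase_wk) ?_) rfl)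
      rw [Ty.erase_ren]
      exact hB.hsubst_expand_zero

/-- Only simple typing of `A` and structural refinement are assumed; both pass to weakened domains
and to codomains without weakening sort formation. -/
theorem Synth.check_expand {Sg : Sig} (hSg : ClosedSig Sg) {Γ : Ctx} {S : Srt} {A : Ty}
    (hA : SimpleTy (eraseSig Sg) ((eraseCtx Γ).map Ty.erase) A) (hS : Refines S A) {R : Atm}
    (hR : Synth Sg Γ R S) : Check Sg Γ (expand A.erase R) S := by
  induction hα : A.erase generalizing Γ S A R with
  | base a =>
    induction hS with
    | atom _ => exact .switch hR (.refl _)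
    | pi => simp [Ty.erase] at hα
    | top => exact .top _ _
    | inter _ _ ih₁ ih₂ => exact .inter (ih₁ hA hR.interLeft hα) (ih₂ hA hR.interRight hα)
  | arr α β ihα ihβ =>
    -- Intersections keep `A` and its simple type while the sort shrinks, hence an inner induction
    -- on refinement; the outer hypotheses serve the Π case.
    induction hS with
    | @atom _ P _ =>
      obtain ⟨a, ha⟩ := P.exists_erase_eq_base
      simp [Ty.erase, ha] at hα
    | @pi S T A B hS hT =>
      simp only [Ty.erase, STy.arr.injEq] at hα
      obtain ⟨rfl, rfl⟩ := hα
      cases hA with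
      | pi hA hB =>
        refine .lam (ihβ (Γ := (S, A) :: Γ) hB hT (.app (hR.wk hSg (S, A))
          (ihα (Γ := (S, A) :: Γ) (hA.wk _) (hS.ren _) (.var (.zero Γ S A)) A.erase_wk) ?_) rfl)
        rw [Ty.erase_ren]
        exact hT.hsubst hB.hsubst_expand_zero
    | top => exact .top _ _
    | inter _ _ ih₁ ih₂ => exact .inter (ih₁ hA hR.interLeft hα) (ih₂ hA hR.interRight hα)

end LFR

theorem mainTheorem3 (Sg : Sig) (hSg : SigOk Sg) :
    -- Expansion
    (∀ (Γ : Ctx) (S : Srt) (A : Ty) (R : Atm),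
      CtxOk Sg Γ → LFCtxOk (eraseSig Sg) (eraseCtx Γ) →
      LFTyOk (eraseSig Sg) (eraseCtx Γ) A → SrtOk Sg Γ S A →
      Synth Sg Γ R S →
        Check Sg Γ (expand A.erase R) S ∧
        (LFSynth (eraseSig Sg) (eraseCtx Γ) R A →
          LFCheck (eraseSig Sg) (eraseCtx Γ) (expand A.erase R) A)) ∧
    -- Identity
    (∀ (Γ : Ctx) (S : Srt) (A : Ty),
      CtxOk Sg Γ → LFCtxOk (eraseSig Sg) (eraseCtx Γ) →
      LFTyOk (eraseSig Sg) (eraseCtx Γ) A → SrtOk Sg Γ S A →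
        Check Sg ((S, A) :: Γ) (expand A.erase (.var 0)) S.wk ∧
        LFCheck (eraseSig Sg) (eraseCtx ((S, A) :: Γ)) (expand A.erase (.var 0)) A.wk) := by
  have hC := hSg.closedSig
  have hLF := hSg.closedLFSig
  refine ⟨fun Γ S A R _ _ hA hS hR =>
    ⟨hR.check_expand hC hA.simple hS.refines, fun h => h.check_expand hLF hA.simple⟩,
    fun Γ S A _ _ hA hS => ?_⟩
  -- Identity is expansion of variable 0 in the extended context, where its type and sort are the
  -- weakened ones.
  rw [← A.erase_wk]
  exact ⟨Synth.check_expand (Γ := (S, A) :: Γ) hC (hA.simple.wk _) (hS.refines.ren _)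
    (.var (.zero Γ S A)),
    LFSynth.check_expand (Γ := A :: eraseCtx Γ) hLF (hA.simple.wk _) (.var (.zero _ A))⟩
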